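/- Consider an anonymous asynchronous ring of $n\ge 1$ nodes, in which each node communicates with its two neighbours through two ports, Port $0$ and Port $1$, assigned to the two neighbours in an arbitrary way that need not be consistent around the ring. Messages carry no content (pulses); they are neither lost nor created by the channels, and a scheduler decides arbitrarily in which order the pulses in transit are received. Each node has its own independent source of randomness, does not know $n$, and acts once at the start and then only upon receiving a pulse. The network is in quiescence when no pulse is in transit. Let $c>0$ be a constant and $p=2^{-1/(c+2)}$. First, without communication, every node $v$ samples $B_v\in\{1,2,\dots\}$ from the geometric distribution with parameter $1-p$, i.e. $\Pr[B_v=k]=p^{k-1}(1-p)$, and then samples $\mathrm{ID}_v$ uniformly from $\{0,1\}^{B_v}$, where the bit strings of length $k$ are identified with the integers $1,\dots,2^{k}$ (one plus the binary value). Then every node $v$ runs the following algorithm, where $\rho_i$ denotes the number of pulses $v$ has received so far at Port $i$. At the start, $v$ sets $\mathrm{ID}_v^{(i)}:=2\,\mathrm{ID}_v-1+i$ for $i\in\{0,1\}$ (or, in the message-saving variant, $\mathrm{ID}_v^{(i)}:=\mathrm{ID}_v+i$), and sends one pulse through each of its ports. Whenever $v$ receives a pulse at Port $1-i$, with $\rho_{1-i}$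 already counting this pulse: 1. it sends a pulse through Port $i$ unless $\rho_{1-i}=\mathrm{ID}_v^{(i)}$; 2. if $\max(\rho_0,\rho_1)\ge \mathrm{ID}_v^{(1)}$, it sets its state to Leader if $\rho_0=\mathrm{ID}_v^{(1)}$ and $\rho_1<\mathrm{ID}_v^{(1)}$, and to Non-Leader otherwise, and it names Port $1$ its clockwise port if $\rho_0>\rho_1$, and Port $0$ otherwise; 3. if $\min(\rho_0,\rho_1)>\mathrm{ID}_v$, it replaces $\mathrm{ID}_v$ by a fresh sample, uniform in $\{1,\dots,\min(\rho_0,\rho_1)-1\}$ (the values $\mathrm{ID}_v^{(0)},\mathrm{ID}_v^{(1)}$ are not changed). Then, with high probability, all nodes hold distinct IDs when the network reaches quiescence. Precisely: there is a universal constant $\kappa>0$ such that for every constant $c>0$ there is an $n_0$ such that for all $n\ge n_0$, for each of the two choices of $\mathrm{ID}_v^{(i)}$ and every assignment of the ports, with probability at least $1-n^{-\kappa c}$ the following holds: under every scheduler, the network reaches quiescence, and at that time the IDs $\mathrm{ID}_v$ are pairwise distinct. -/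

import Mathlib

namespace AnonRing

open MeasureTheory ProbabilityTheory

/-! ### Sampling the initial IDs (no communication) -/

/-- The parameter `1 - p` of the geometric distribution, where `p = 2 ^ (-1 / (c + 2))`. -/
noncomputable def geoParam (c : ℝ) (hc : 0 < c) : unitInterval :=
  ⟨1 - (2 : ℝ) ^ (-1 / (c + 2)), by
    have h0 : (0 : ℝ) ≤ (2 : ℝ) ^ (-1 / (c + 2)) := by positivity
    have h1 : (2 : ℝ) ^ (-1 / (c + 2)) ≤ 1 :=
      Real.rpow_le_one_of_one_le_of_nonpos (by norm_num)
        (div_nonpos_of_nonpos_of_nonneg (by norm_num) (by linarith))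
    exact ⟨by linarith, by linarith⟩⟩

/-- A bit string of length `k`, read as a positive integer: one plus its binary value. This
identifies `{0,1}^k` with `{1, ..., 2^k}` (IDs are positive integers). -/
def bitsToId {k : ℕ} (b : Fin k → Bool) : ℕ :=
  1 + ∑ i : Fin k, (b i).toNat * 2 ^ (i : ℕ)

/-- The law of a sampled ID: `BitCount` is geometric with parameter `1 - p` on `{1, 2, ...}`, then
the ID is uniform over the bit strings of length `BitCount`. Mathlib's geometric law counts the
failures before the first success, so it is the law of `BitCount - 1`. -/
noncomputable def sampledId (c : ℝ) (hc : 0 < c) : PMF ℕ :=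
  (geometricMeasure (geoParam c hc)).toPMF.bind fun k =>
    (PMF.uniformOfFintype (Fin (k + 1) → Bool)).map bitsToId

/-! ### The nodes' sources of randomness -/

/-- The uniform law on `{1, ..., m}` for `m ≥ 1` (for `m = 0`, which is never used, on `{1}`). -/
noncomputable def uniformUpTo (m : ℕ) : PMF ℕ :=
  PMF.uniformOfFinset (Finset.Icc 1 (max 1 m)) ⟨1, by simp⟩

/-- The randomness of one node: its initially sampled ID, and its coins. The coin `(j, m)` is the
value that the node draws if it samples uniformly from `{1, ..., m}` upon receiving its `j`-th
pulse. -/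
abbrev NodeSource : Type := ℕ × (ℕ × ℕ → ℕ)

/-- The law of one node's randomness: the initial ID and all the coins are independent. -/
noncomputable def nodeSourceLaw (c : ℝ) (hc : 0 < c) : Measure NodeSource :=
  (sampledId c hc).toMeasure.prod
    (Measure.infinitePi fun i : ℕ × ℕ => (uniformUpTo i.2).toMeasure)

/-- The randomness of all the nodes of a ring of size `n`; distinct nodes are independent. -/
noncomputable def networkLaw (c : ℝ) (hc : 0 < c) (n : ℕ) [NeZero n] :
    Measure (ZMod n → NodeSource) :=
  Measure.pi fun _ => nodeSourceLaw c hc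

/-! ### The algorithm of a node

Ports are Booleans: `false` is Port 0 and `true` is Port 1. -/

/-- The two ways to choose the virtual IDs of a node: `ID⁽ⁱ⁾ = 2 * ID - 1 + i`, or the
message-saving variant `ID⁽ⁱ⁾ = ID + i`. -/
inductive VirtualIdRule
  | doubling
  | successor

/-- The virtual ID `ID⁽ⁱ⁾`, as a function of the ID (which is at least `1`). -/
def VirtualIdRule.virtualId : VirtualIdRule → ℕ → Bool → ℕ
  | doubling, x, i => 2 * x - 1 + i.toNat
  | successor, x, i => x + i.toNat

/-- The local variables of a node: its current ID, its two virtual IDs, the numbers of pulses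
received so far at the two ports, its output (`some true` is Leader, `some false` is Non-Leader),
and the port it names clockwise. -/
structure NodeState where
  id : ℕ
  virt : Bool → ℕ
  recv : Bool → ℕ
  leader : Option Bool
  cwPort : Option Bool

/-- The state of a node after its initialization. The virtual IDs are fixed here once and for
all. -/
def NodeState.init (rule : VirtualIdRule) (src : NodeSource) : NodeState where
  id := src.1
  virt := rule.virtualId src.1
  recv := fun _ => 0
  leader := none
  cwPort := none

/-- Count a pulse received at port `p`. -/
def NodeState.count (s : NodeState) (p : Bool) : NodeState :=
  { s with recv := Function.update s.recv p (s.recv p + 1) }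

/-- Whether the pulse just received (and counted) at port `p = 1 - i` is forwarded through the
opposite port `i`: it is unless the count equals `ID⁽ⁱ⁾`. -/
def NodeState.forwards (s : NodeState) (p : Bool) : Prop :=
  s.recv p ≠ s.virt (!p)

instance (s : NodeState) (p : Bool) : Decidable (s.forwards p) :=
  inferInstanceAs (Decidable (_ ≠ _))

/-- Recompute the output of the node. -/
def NodeState.computeOutput (s : NodeState) : NodeState :=
  if s.virt true ≤ max (s.recv false) (s.recv true) then
    { s with
      leader := some (decide (s.recv false = s.virt true ∧ s.recv true < s.virt true))
      cwPort := some (decide (s.recv true < s.recv false)) }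
  else s

/-- The modification: if the smaller of the two counts, `m`, exceeds the ID, then the ID is
replaced by a fresh uniform sample from `{1, ..., m - 1}`. -/
def NodeState.resample (coin : ℕ × ℕ → ℕ) (s : NodeState) : NodeState :=
  let m := min (s.recv false) (s.recv true)
  if s.id < m then { s with id := coin (s.recv false + s.recv true, m - 1) } else s

/-! ### The ring and its executions -/

/-- The wiring of a ring with nodes `ZMod n`, arranged cyclically, where the ports of each node are
assigned arbitrarily: Port 1 of `v` leads to `v + 1` and Port 0 to `v - 1` if `flip v = false`, and
conversely if `flip v = true`. The port at the other end of the edge at port `e.2` of node `e.1`. -/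
def peer {n : ℕ} (flip : ZMod n → Bool) (e : ZMod n × Bool) : ZMod n × Bool :=
  if e.2 = flip e.1 then (e.1 - 1, !flip (e.1 - 1)) else (e.1 + 1, flip (e.1 + 1))

/-- A global configuration: the nodes' states, and for each port of each node the number of pulses
sent through that port that have not been received yet. -/
structure Config (n : ℕ) where
  node : ZMod n → NodeState
  transit : ZMod n × Bool → ℕ

/-- Initially every node sends one pulse through each of its ports. -/
def Config.init {n : ℕ} (rule : VirtualIdRule) (ω : ZMod n → NodeSource) : Config n where
  node := fun v => NodeState.init rule (ω v)
  transit := fun _ => 1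

/-- A pulse sent through port `e` is received at the other end `peer flip e` by the node there,
which reacts: it counts the pulse, possibly forwards it through its opposite port, recomputes its
output and possibly resamples its ID. -/
def Config.deliver {n : ℕ} (flip : ZMod n → Bool) (ω : ZMod n → NodeSource) (C : Config n)
    (e : ZMod n × Bool) : Config n :=
  let u := (peer flip e).1
  let q := (peer flip e).2
  let s := (C.node u).count q
  let t := Function.update C.transit e (C.transit e - 1)
  { node := Function.update C.node u (s.computeOutput.resample (ω u).2)
    transit := if s.forwards q then Function.update t (u, !q) (t (u, !q) + 1) else t }

/-- One asynchronous step: some pulse in transit, chosen arbitrarily, is received. -/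
def Step {n : ℕ} (flip : ZMod n → Bool) (ω : ZMod n → NodeSource) (C C' : Config n) : Prop :=
  ∃ e, 0 < C.transit e ∧ C' = C.deliver flip ω e

/-- Quiescence: no pulse is in transit. -/
def Config.Quiescent {n : ℕ} (C : Config n) : Prop :=
  ∀ e, C.transit e = 0

/-- An execution, under an arbitrary scheduler: pulses are received one after the other as long as
some pulse is in transit; afterwards nothing changes. -/
structure IsExecution {n : ℕ} (rule : VirtualIdRule) (flip : ZMod n → Bool)
    (ω : ZMod n → NodeSource) (E : ℕ → Config n) : Prop where
  start : E 0 = Config.init rule ω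
  next : ∀ t, Step flip ω (E t) (E (t + 1)) ∨ ((E t).Quiescent ∧ E (t + 1) = E t)

/-- For the outcome `ω` of the randomness, every execution reaches quiescence, and when it does, the
IDs held by the nodes are pairwise distinct. -/
def DistinctIdsAtQuiescence {n : ℕ} (rule : VirtualIdRule) (flip : ZMod n → Bool)
    (ω : ZMod n → NodeSource) : Prop :=
  ∀ E : ℕ → Config n, IsExecution rule flip ω E →
    (∃ t, (E t).Quiescent) ∧
      ∀ t, (E t).Quiescent → Function.Injective fun v => ((E t).node v).id

end AnonRing

/-! The two directions of travel do not interact. In each of them the ring starts with one pulse per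
node, and every node absorbs exactly one: the pulse that brings its count to its threshold. This
gives a balance equation on every edge (`Config.Invariant`). Counts never exceed the largest
threshold, so every execution ends. At quiescence, summing the balance around the ring shows that
every node has absorbed its pulse. All counts then agree, and equal the largest threshold
(`Config.Invariant.received_eq`).

So the final counts, and hence the index of the coin that a resampling node ends with, depend on the
initial IDs alone, not on the scheduler. Their minimum m is at least every initial ID. A node with
ID m keeps it, while the others hold a uniform value below m. If some initial ID exceeds T, a clash
is therefore either between two equal initial IDs above T, or between two coins uniform on at least
T values (`bad_of_not_distinctIdsAtQuiescence`).

Each point x has mass at most 1/x under the ID law, and the coins are independent of the IDs, so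
each kind of clash has probability at most n²/T. With T = 2^K near n^(2 + c/2), this is about
n^(-c/2). The heavy geometric tail makes it superpolynomially unlikely that no ID exceeds T
(`exists_forall_failure_le`). -/

namespace AnonRing

open MeasureTheory ProbabilityTheory

/-! ### The two directions of travel -/

section Deterministic

variable {n : ℕ}

/-- The port at which node `v` receives the pulses travelling in direction `d`, where `false` is the
direction from `v` to `v + 1`, and `true` the opposite one. -/
def inPort (flip : ZMod n → Bool) (d : Bool) (v : ZMod n) : Bool :=
  xor (flip v) d

/-- The node after `v` in direction `d`. -/
def nextNode (d : Bool) (v : ZMod n) : ZMod n :=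
  if d then v - 1 else v + 1

theorem nextNode_inj {d : Bool} {v w : ZMod n} : nextNode d v = nextNode d w ↔ v = w := by
  cases d <;> simp [nextNode]

theorem inPort_inj {flip : ZMod n → Bool} {d d' : Bool} {v : ZMod n} :
    inPort flip d v = inPort flip d' v ↔ d = d' := by
  simp [inPort]

theorem peer_outPort (flip : ZMod n → Bool) (d : Bool) (v : ZMod n) :
    peer flip (v, !inPort flip d v) = (nextNode d v, inPort flip d (nextNode d v)) := by
  cases d <;> cases h : flip v <;> simp [peer, inPort, nextNode, h]

theorem exists_eq_outPort (flip : ZMod n → Bool) (e : ZMod n × Bool) :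
    ∃ d v, e = (v, !inPort flip d v) := by
  obtain ⟨v, p⟩ := e
  refine ⟨!(xor (flip v) p), v, ?_⟩
  cases h : flip v <;> cases p <;> simp [inPort, h]

/-- The number of pulses travelling in direction `d` that node `v` has received. -/
def Config.received (C : Config n) (flip : ZMod n → Bool) (d : Bool) (v : ZMod n) : ℕ :=
  (C.node v).recv (inPort flip d v)

/-- The number of pulses in transit from node `v` to the next node in direction `d`. -/
def Config.leaving (C : Config n) (flip : ZMod n → Bool) (d : Bool) (v : ZMod n) : ℕ :=
  C.transit (v, !inPort flip d v)

/-- The count at which node `v` absorbs a pulse travelling in direction `d`. -/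
def threshold (rule : VirtualIdRule) (flip : ZMod n → Bool) (ω : ZMod n → NodeSource) (d : Bool)
    (v : ZMod n) : ℕ :=
  rule.virtualId (ω v).1 (!inPort flip d v)

/-- The largest threshold in direction `d`. -/
def maxThreshold [NeZero n] (rule : VirtualIdRule) (flip : ZMod n → Bool)
    (ω : ZMod n → NodeSource) (d : Bool) : ℕ :=
  Finset.univ.sup (threshold rule flip ω d)

theorem threshold_le_maxThreshold [NeZero n] (rule : VirtualIdRule) (flip : ZMod n → Bool)
    (ω : ZMod n → NodeSource) (d : Bool) (v : ZMod n) :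
    threshold rule flip ω d v ≤ maxThreshold rule flip ω d :=
  Finset.le_sup (f := threshold rule flip ω d) (Finset.mem_univ v)

theorem id_le_threshold (rule : VirtualIdRule) (flip : ZMod n → Bool) {ω : ZMod n → NodeSource}
    (d : Bool) (v : ZMod n) (h : 1 ≤ (ω v).1) : (ω v).1 ≤ threshold rule flip ω d v := by
  cases rule <;> simp only [threshold, VirtualIdRule.virtualId] <;> omega

/-! ### The invariant and its preservation by a step -/

/-- The ID that a node with randomness `src` holds once its counts are `r`. -/
def idAfter (src : NodeSource) (r : Bool → ℕ) : ℕ :=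
  if min (r false) (r true) ≤ src.1 then src.1
  else src.2 (r false + r true, min (r false) (r true) - 1)

/-- The initial ID is positive, and every coin takes a value it may take. -/
def NodeSource.Regular (src : NodeSource) : Prop :=
  1 ≤ src.1 ∧ ∀ j m, src.2 (j, m) ∈ Finset.Icc 1 (max 1 m)

/-- What holds throughout an execution. -/
structure Config.Invariant [NeZero n] (rule : VirtualIdRule) (flip : ZMod n → Bool)
    (ω : ZMod n → NodeSource) (C : Config n) : Prop where
  virt : ∀ v, (C.node v).virt = rule.virtualId (ω v).1
  balance : ∀ d v, C.leaving flip d v + C.received flip d (nextNode d v) +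
      (if threshold rule flip ω d v ≤ C.received flip d v then 1 else 0) =
    1 + C.received flip d v
  bound : ∀ d v, C.received flip d v ≤ maxThreshold rule flip ω d
  id : ∀ v, (C.node v).id = idAfter (ω v) (C.node v).recv

theorem Config.invariant_init [NeZero n] (rule : VirtualIdRule) (flip : ZMod n → Bool)
    {ω : ZMod n → NodeSource} (hω : ∀ v, (ω v).Regular) :
    (Config.init rule ω).Invariant rule flip ω where
  virt v := rfl
  balance d v := by
    have h := id_le_threshold rule flip d v (hω v).1
    have h' := (hω v).1
    have h0 : (Config.init rule ω).received flip d v = 0 := rfl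
    rw [if_neg (by omega)]
    rfl
  bound d v := Nat.zero_le _
  id v := by simp [Config.init, NodeState.init, idAfter]

theorem NodeState.computeOutput_eq (s : NodeState) :
    s.computeOutput.id = s.id ∧ s.computeOutput.virt = s.virt ∧ s.computeOutput.recv = s.recv := by
  unfold NodeState.computeOutput
  split_ifs <;> simp

theorem NodeState.resample_eq (coin : ℕ × ℕ → ℕ) (s : NodeState) :
    (s.resample coin).virt = s.virt ∧ (s.resample coin).recv = s.recv := by
  unfold NodeState.resample
  dsimp only
  split_ifs <;> simp

/-- A coin drawn from {1, ..., m - 1} lies below m, and m never decreases. Once a node has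
resampled, it therefore resamples at every later pulse, and its current ID depends only on its
current counts. -/
theorem idAfter_count {src : NodeSource} (hsrc : src.Regular) {s : NodeState}
    (hs : s.id = idAfter src s.recv) (q : Bool) :
    ((s.count q).computeOutput.resample src.2).id = idAfter src (s.count q).recv := by
  obtain ⟨h1, h2, h3⟩ := (s.count q).computeOutput_eq
  obtain ⟨hpos, hcoin⟩ := hsrc
  have hid : (s.count q).id = s.id := rfl
  have hmono : min (s.recv false) (s.recv true) ≤
      min ((s.count q).recv false) ((s.count q).recv true) := by
    cases q <;> simp [NodeState.count, Function.update]
  unfold NodeState.resample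
  rw [h3, h1, hid, hs]
  unfold idAfter
  have hc := hcoin (s.recv false + s.recv true) (min (s.recv false) (s.recv true) - 1)
  rw [Finset.mem_Icc] at hc
  dsimp only
  split_ifs <;> first | rfl | omega | (simp only [h1, hid, hs, idAfter]; split_ifs; omega)

variable {rule : VirtualIdRule} {flip : ZMod n → Bool} {ω : ZMod n → NodeSource}

theorem Config.received_deliver (C : Config n) (d₀ d : Bool) (v₀ v : ZMod n) :
    (C.deliver flip ω (v₀, !inPort flip d₀ v₀)).received flip d v =
      C.received flip d v + if d = d₀ ∧ v = nextNode d₀ v₀ then 1 else 0 := by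
  simp only [Config.received, Config.deliver, peer_outPort]
  by_cases hv : v = nextNode d₀ v₀
  · subst hv
    rw [Function.update_self, (NodeState.resample_eq _ _).2, (NodeState.computeOutput_eq _).2.2]
    by_cases hd : d = d₀
    · subst hd
      simp [NodeState.count]
    · have : inPort flip d (nextNode d₀ v₀) ≠ inPort flip d₀ (nextNode d₀ v₀) := by rwa [Ne, inPort_inj]
      simp [NodeState.count, this, hd]
  · simp [hv]

theorem update_succ_apply {α : Type*} [DecidableEq α] (t : α → ℕ) (a b : α) (P : Prop)
    [Decidable P] :
    (if P then Function.update t a (t a + 1) else t) b = t b + if b = a ∧ P then 1 else 0 := by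
  by_cases h : b = a <;> by_cases hP : P <;> simp [h, hP]

theorem update_pred_apply {α : Type*} [DecidableEq α] {t : α → ℕ} {a : α} (ha : 0 < t a) (b : α) :
    Function.update t a (t a - 1) b + (if b = a then 1 else 0) = t b := by
  by_cases h : b = a
  · subst h
    simp only [Function.update_self, if_true]
    omega
  · simp [h]

theorem Config.leaving_deliver {C : Config n} (hvirt : ∀ v, (C.node v).virt = rule.virtualId (ω v).1)
    (d₀ d : Bool) (v₀ v : ZMod n) (h : 0 < C.leaving flip d₀ v₀) :
    (C.deliver flip ω (v₀, !inPort flip d₀ v₀)).leaving flip d v +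
        (if d = d₀ ∧ v = v₀ then 1 else 0) =
      C.leaving flip d v + if (d = d₀ ∧ v = nextNode d₀ v₀) ∧
        C.received flip d v + 1 ≠ threshold rule flip ω d v then 1 else 0 := by
  have key : ∀ w : ZMod n, (v, !inPort flip d v) = (w, !inPort flip d₀ w) ↔ d = d₀ ∧ v = w := by
    intro w
    constructor
    · intro hh
      obtain ⟨rfl, h2⟩ := Prod.mk.inj hh
      exact ⟨inPort_inj.1 (by simpa using h2), rfl⟩
    · rintro ⟨rfl, rfl⟩
      rfl
  have hf : ((C.node (nextNode d₀ v₀)).count (inPort flip d₀ (nextNode d₀ v₀))).forwards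
      (inPort flip d₀ (nextNode d₀ v₀)) ↔
      C.received flip d₀ (nextNode d₀ v₀) + 1 ≠ threshold rule flip ω d₀ (nextNode d₀ v₀) := by
    simp [NodeState.forwards, NodeState.count, hvirt, threshold, Config.received]
  simp only [Config.leaving] at h ⊢
  simp only [Config.deliver, peer_outPort, hf, update_succ_apply, key]
  have h1 := update_pred_apply h (v, !inPort flip d v)
  simp only [key] at h1
  have h2 : ((d = d₀ ∧ v = nextNode d₀ v₀) ∧
      C.received flip d₀ (nextNode d₀ v₀) + 1 ≠ threshold rule flip ω d₀ (nextNode d₀ v₀)) ↔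
      ((d = d₀ ∧ v = nextNode d₀ v₀) ∧ C.received flip d v + 1 ≠ threshold rule flip ω d v) := by
    constructor <;> (rintro ⟨⟨rfl, rfl⟩, h⟩; exact ⟨⟨rfl, rfl⟩, h⟩)
  simp only [h2]
  omega

theorem Config.Invariant.deliver [NeZero n] {C : Config n} (hC : C.Invariant rule flip ω)
    (hω : ∀ v, (ω v).Regular) {e : ZMod n × Bool} (he : 0 < C.transit e) :
    (C.deliver flip ω e).Invariant rule flip ω := by
  obtain ⟨d₀, v₀, rfl⟩ := exists_eq_outPort flip e
  have hvirt : ∀ v, ((C.deliver flip ω (v₀, !inPort flip d₀ v₀)).node v).virt =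
      rule.virtualId (ω v).1 := by
    intro v
    simp only [Config.deliver, peer_outPort]
    by_cases hv : v = nextNode d₀ v₀
    · subst hv
      rw [Function.update_self, (NodeState.resample_eq _ _).1, (NodeState.computeOutput_eq _).2.1]
      exact hC.virt _
    · rw [Function.update_of_ne hv]
      exact hC.virt v
  refine ⟨hvirt, fun d v => ?_, fun d v => ?_, fun v => ?_⟩
  · have h1 := C.received_deliver (flip := flip) (ω := ω) d₀ d v₀ v
    have h2 := C.received_deliver (flip := flip) (ω := ω) d₀ d v₀ (nextNode d v)
    have h3 := Config.leaving_deliver hC.virt d₀ d v₀ v he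
    have h4 := hC.balance d v
    rw [h1, h2]
    by_cases hd : d = d₀
    · subst hd
      simp only [true_and, nextNode_inj] at h1 h2 h3 ⊢
      rw [ite_and] at h3
      -- The pulse that is not forwarded is exactly the one that switches on the indicator in the
      -- balance. The case v₀ = `nextNode d v₀` (n = 1) is included.
      split_ifs at h3 h4 ⊢ <;> omega
    · simp only [hd, false_and, if_false, add_zero] at h1 h2 h3 ⊢
      rw [h3, h4]
  · rw [C.received_deliver]
    split_ifs with h
    · obtain ⟨rfl, rfl⟩ := h
      -- A pulse leaving v₀ puts the receiver strictly behind v₀ if v₀ has reached its threshold.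
      -- Otherwise the receiver is at most level with v₀, whose count is still below the threshold.
      have h4 := hC.balance d v₀
      have h5 := hC.bound d v₀
      have h6 := threshold_le_maxThreshold rule flip ω d v₀
      have he' : 0 < C.leaving flip d v₀ := he
      split_ifs at h4 <;> omega
    · exact hC.bound d v
  · simp only [Config.deliver, peer_outPort]
    by_cases hv : v = nextNode d₀ v₀
    · subst hv
      rw [Function.update_self, (NodeState.resample_eq _ _).2, (NodeState.computeOutput_eq _).2.2]
      exact idAfter_count (hω _) (hC.id _) _
    · rw [Function.update_of_ne hv]
      exact hC.id v

/-! ### Termination and the state at quiescence -/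

theorem IsExecution.invariant [NeZero n] {E : ℕ → Config n} (hE : IsExecution rule flip ω E)
    (hω : ∀ v, (ω v).Regular) (t : ℕ) : (E t).Invariant rule flip ω := by
  induction t with
  | zero => exact hE.start ▸ Config.invariant_init rule flip hω
  | succ t ih =>
    rcases hE.next t with ⟨e, he, h⟩ | ⟨-, h⟩
    · exact h ▸ ih.deliver hω he
    · exact h ▸ ih

theorem IsExecution.exists_quiescent [NeZero n] {E : ℕ → Config n}
    (hE : IsExecution rule flip ω E) (hω : ∀ v, (ω v).Regular) : ∃ t, (E t).Quiescent := by
  by_contra! hq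
  -- Each delivery raises the total count by one, while the invariant bounds that total.
  have hsum : ∀ t, t ≤ ∑ x : Bool × ZMod n, (E t).received flip x.1 x.2 := by
    intro t
    induction t with
    | zero => exact Nat.zero_le _
    | succ t ih =>
      rcases hE.next t with ⟨e, he, h⟩ | ⟨h, -⟩
      · obtain ⟨d₀, v₀, rfl⟩ := exists_eq_outPort flip e
        rw [h]
        simp only [Config.received_deliver, Finset.sum_add_distrib]
        have : (1 : ℕ) ≤ ∑ x : Bool × ZMod n,
            if x.1 = d₀ ∧ x.2 = nextNode d₀ v₀ then 1 else 0 := by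
          refine le_trans ?_ (Finset.single_le_sum (f := fun x : Bool × ZMod n =>
            if x.1 = d₀ ∧ x.2 = nextNode d₀ v₀ then 1 else 0) (fun _ _ => Nat.zero_le _)
            (Finset.mem_univ (d₀, nextNode d₀ v₀)))
          simp
        omega
      · exact absurd h (hq t)
  have hle : ∀ t, ∑ x : Bool × ZMod n, (E t).received flip x.1 x.2 ≤
      ∑ x : Bool × ZMod n, maxThreshold rule flip ω x.1 := fun t =>
    Finset.sum_le_sum fun x _ => (hE.invariant hω t).bound x.1 x.2
  have := (hsum _).trans (hle (∑ x : Bool × ZMod n, maxThreshold rule flip ω x.1 + 1))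
  omega

theorem eq_of_nextNode_eq {d : Bool} {R : ZMod n → ℕ} (h : ∀ v, R (nextNode d v) = R v) (v w : ZMod n) :
    R v = R w := by
  have h1 : ∀ v, R (v + 1) = R v := by
    intro v
    cases d
    · exact h v
    · simpa [nextNode] using (h (v + 1)).symm
  have h2 : ∀ (k : ℤ) (v : ZMod n), R (v + k) = R v := by
    intro k
    induction k with
    | zero => simp
    | succ k ih => intro v; rw [← ih v, ← h1 (v + (k : ℤ))]; congr 1; push_cast; ring
    | pred k ih =>
      intro v
      rw [← ih v, ← h1 (v + (-(k : ℤ) - 1 : ℤ))]; congr 1; push_cast; ring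
  obtain ⟨k, hk⟩ := ZMod.intCast_surjective (v - w)
  rw [← h2 k w, hk]
  congr 1
  ring

/-- At quiescence every node has received exactly `maxThreshold` pulses in each direction. -/
theorem Config.Invariant.received_eq [NeZero n] {C : Config n} (hC : C.Invariant rule flip ω)
    (hq : C.Quiescent) (d : Bool) (v : ZMod n) :
    C.received flip d v = maxThreshold rule flip ω d := by
  have hbal : ∀ v, C.received flip d (nextNode d v) +
      (if threshold rule flip ω d v ≤ C.received flip d v then 1 else 0) =
        1 + C.received flip d v := by
    intro v
    have := hC.balance d v
    rw [show C.leaving flip d v = 0 from hq _, zero_add] at this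
    exact this
  have hbij : Function.Bijective (nextNode d : ZMod n → ZMod n) :=
    Finite.injective_iff_bijective.1 fun v w h => nextNode_inj.1 h
  -- Summed around the ring, the counts cancel, which forces every indicator to be 1.
  have hsum : ∑ v : ZMod n, (if threshold rule flip ω d v ≤ C.received flip d v then 1 else 0) =
      ∑ v : ZMod n, 1 := by
    have h1 := Finset.sum_congr (s₁ := Finset.univ) rfl fun v _ => hbal v
    rw [Finset.sum_add_distrib, Finset.sum_add_distrib,
      hbij.sum_comp (fun v => C.received flip d v)] at h1
    omega
  have hthr : ∀ v, threshold rule flip ω d v ≤ C.received flip d v := by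
    have h2 := (Finset.sum_eq_sum_iff_of_le (fun v _ => by split_ifs <;> simp)).1 hsum
    intro v
    by_contra hv
    simpa [hv] using h2 v (Finset.mem_univ v)
  have hconst := eq_of_nextNode_eq (d := d) (R := C.received flip d) fun v => by
    have := hbal v
    rw [if_pos (hthr v)] at this
    omega
  refine le_antisymm (hC.bound d v) (Finset.sup_le fun w _ => ?_)
  rw [hconst v w]
  exact hthr w

/-- The smaller of the two counts that every node has at quiescence. -/
def finalMin [NeZero n] (rule : VirtualIdRule) (flip : ZMod n → Bool)
    (ω : ZMod n → NodeSource) : ℕ :=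
  min (maxThreshold rule flip ω false) (maxThreshold rule flip ω true)

/-- The number of pulses that every node has received at quiescence. -/
def finalSum [NeZero n] (rule : VirtualIdRule) (flip : ZMod n → Bool)
    (ω : ZMod n → NodeSource) : ℕ :=
  maxThreshold rule flip ω false + maxThreshold rule flip ω true

theorem Config.Invariant.id_eq [NeZero n] {C : Config n} (hC : C.Invariant rule flip ω)
    (hq : C.Quiescent) (v : ZMod n) :
    (C.node v).id = if finalMin rule flip ω ≤ (ω v).1 then (ω v).1
      else (ω v).2 (finalSum rule flip ω, finalMin rule flip ω - 1) := by
  have h0 := hC.received_eq hq false v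
  have h1 := hC.received_eq hq true v
  rw [hC.id v, idAfter, finalMin, finalSum, ← h0, ← h1]
  -- `flip v` only swaps the two counts, and the minimum and the sum are symmetric.
  cases h : flip v <;> simp [Config.received, inPort, h, min_comm, add_comm]

theorem id_le_finalMin [NeZero n] (hω : ∀ v, (ω v).Regular) (v : ZMod n) :
    (ω v).1 ≤ finalMin rule flip ω :=
  le_min ((id_le_threshold rule flip _ v (hω v).1).trans (threshold_le_maxThreshold ..))
    ((id_le_threshold rule flip _ v (hω v).1).trans (threshold_le_maxThreshold ..))

/-- The ways in which the IDs at quiescence can fail to be distinct, for any cutoff `T ≥ 1`: no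
initial ID exceeds `T`, or two of those that do coincide, or two nodes draw the same coin. -/
theorem bad_of_not_distinctIdsAtQuiescence [NeZero n] (hω : ∀ v, (ω v).Regular) {T : ℕ}
    (hT : 1 ≤ T) (h : ¬ DistinctIdsAtQuiescence rule flip ω) :
    (∀ v, (ω v).1 ≤ T) ∨ ∃ u v, u ≠ v ∧ ((T < (ω u).1 ∧ (ω u).1 = (ω v).1) ∨
      (T ≤ finalMin rule flip ω - 1 ∧ (ω u).2 (finalSum rule flip ω, finalMin rule flip ω - 1) =
        (ω v).2 (finalSum rule flip ω, finalMin rule flip ω - 1))) := by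
  by_contra hbad
  push Not at hbad
  obtain ⟨⟨w, hw⟩, hbad⟩ := hbad
  refine h fun E hE => ⟨hE.exists_quiescent hω, fun t ht u v huv => ?_⟩
  by_contra hne
  have hinv := hE.invariant hω t
  simp only [hinv.id_eq ht] at huv
  have hm := id_le_finalMin (rule := rule) (flip := flip) hω w
  have hcu := (hω u).2 (finalSum rule flip ω) (finalMin rule flip ω - 1)
  have hcv := (hω v).2 (finalSum rule flip ω) (finalMin rule flip ω - 1)
  rw [Finset.mem_Icc] at hcu hcv
  have hb := hbad u v hne
  split_ifs at huv with h1 h2 h2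
  · exact hb.1 (by omega) huv
  · omega
  · omega
  · exact hb.2 (by omega) huv

end Deterministic

/-! ### The law of the sampled IDs -/

theorem bitsToId_eq {k : ℕ} (b : Fin k → Bool) :
    bitsToId b = 1 + (finFunctionFinEquiv fun i => finTwoEquiv.symm (b i) : Fin (2 ^ k)) := by
  rw [finFunctionFinEquiv_apply, bitsToId]
  congr 1
  refine Finset.sum_congr rfl fun i _ => ?_
  cases b i <;> simp [finTwoEquiv]

theorem bitsToId_injective {k : ℕ} : Function.Injective (bitsToId : (Fin k → Bool) → ℕ) := by
  intro a b h
  rw [bitsToId_eq, bitsToId_eq] at h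
  have h' := finFunctionFinEquiv.injective (Fin.ext (Nat.add_left_cancel h))
  funext i
  exact finTwoEquiv.symm.injective (congrFun h' i)

theorem bitsToId_le {k : ℕ} (b : Fin k → Bool) : bitsToId b ≤ 2 ^ k := by
  rw [bitsToId_eq, add_comm]
  exact (finFunctionFinEquiv fun i => finTwoEquiv.symm (b i)).isLt

theorem one_le_bitsToId {k : ℕ} (b : Fin k → Bool) : 1 ≤ bitsToId b :=
  Nat.le_add_right 1 _

theorem map_bitsToId_apply_le (k x : ℕ) :
    (PMF.uniformOfFintype (Fin k → Bool)).map bitsToId x ≤ (x : ENNReal)⁻¹ := by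
  rw [PMF.map_apply]
  by_cases hx : ∃ b : Fin k → Bool, x = bitsToId b
  · obtain ⟨b, rfl⟩ := hx
    rw [tsum_eq_single b]
    · rw [if_pos rfl, PMF.uniformOfFintype_apply]
      refine ENNReal.inv_le_inv.2 ?_
      have := bitsToId_le b
      simp only [Fintype.card_fun, Fintype.card_bool, Fintype.card_fin]
      exact_mod_cast this
    · intro a ha
      exact if_neg fun h => ha (bitsToId_injective h).symm
  · push Not at hx
    simp [hx]

/-- Given the length k, a value x that can occur has mass 2^(-k) and satisfies x ≤ 2^k. The bound
1/x is the same for all lengths, so it survives the mixture. -/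
theorem sampledId_apply_le (c : ℝ) (hc : 0 < c) (x : ℕ) : sampledId c hc x ≤ (x : ENNReal)⁻¹ := by
  rw [sampledId, PMF.bind_apply]
  calc _ ≤ ∑' k, (geometricMeasure (geoParam c hc)).toPMF k * (x : ENNReal)⁻¹ :=
        ENNReal.tsum_le_tsum fun k => mul_le_mul_right (map_bitsToId_apply_le (k + 1) x) _
    _ = (x : ENNReal)⁻¹ := by rw [ENNReal.tsum_mul_right, PMF.tsum_coe, one_mul]

theorem sampledId_zero (c : ℝ) (hc : 0 < c) : sampledId c hc 0 = 0 := by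
  refine (PMF.apply_eq_zero_iff _ _).2 fun h => ?_
  simp only [sampledId, PMF.mem_support_bind_iff, PMF.mem_support_map_iff] at h
  obtain ⟨k, -, b, -, hb⟩ := h
  have := one_le_bitsToId b
  omega

/-- By injectivity, at most 2^K of the 2^(K+1) strings can land in {1, ..., 2^K}. -/
theorem half_le_map_bitsToId (K : ℕ) :
    2⁻¹ ≤ ((PMF.uniformOfFintype (Fin (K + 1) → Bool)).map bitsToId).toMeasure
      (Set.Ioi (2 ^ K)) := by
  classical
  rw [← PMF.toMeasure_map _ _ (measurable_of_countable _), Measure.map_apply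
    (measurable_of_countable _) (measurableSet_Ioi), PMF.toMeasure_uniformOfFintype_apply _
    (Set.toFinite _).measurableSet]
  have hle : Fintype.card {b : Fin (K + 1) → Bool // ¬ 2 ^ K < bitsToId b} ≤ 2 ^ K := by
    have := Fintype.card_le_of_injective
      (fun b : {b : Fin (K + 1) → Bool // ¬ 2 ^ K < bitsToId b} =>
        (⟨bitsToId b.1, Finset.mem_Icc.2 ⟨one_le_bitsToId _, not_lt.1 b.2⟩⟩ :
          Finset.Icc 1 (2 ^ K)))
      fun a b h => Subtype.ext (bitsToId_injective (congrArg Subtype.val h))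
    simpa using this
  have hadd := Fintype.card_subtype_compl fun b : Fin (K + 1) → Bool => 2 ^ K < bitsToId b
  have hge : 2 ^ K ≤ Fintype.card {b : Fin (K + 1) → Bool // 2 ^ K < bitsToId b} := by
    have h2 : Fintype.card (Fin (K + 1) → Bool) = 2 ^ K + 2 ^ K := by
      simp [pow_succ, mul_two]
    omega
  have hcard : Fintype.card ↑((bitsToId : (Fin (K + 1) → Bool) → ℕ) ⁻¹' Set.Ioi (2 ^ K)) =
      Fintype.card {b : Fin (K + 1) → Bool // 2 ^ K < bitsToId b} :=
    Fintype.card_congr (Equiv.refl _)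
  rw [hcard, ENNReal.le_div_iff_mul_le (by simp) (by simp)]
  simp only [Fintype.card_fun, Fintype.card_bool, Fintype.card_fin]
  calc (2⁻¹ : ENNReal) * ((2 ^ (K + 1) : ℕ) : ENNReal) = ((2 ^ K : ℕ) : ENNReal) := by
        push_cast
        rw [pow_succ', ← mul_assoc, ENNReal.inv_mul_cancel (by simp) (by simp), one_mul]
    _ ≤ _ := by exact_mod_cast hge

/-- The base `p = 2 ^ (-1 / (c + 2))` of the tail of the geometric distribution. -/
noncomputable def geoTail (c : ℝ) : ℝ :=
  (2 : ℝ) ^ (-1 / (c + 2))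

theorem geoTail_pos (c : ℝ) : 0 < geoTail c := by
  unfold geoTail
  positivity

theorem geoTail_lt_one {c : ℝ} (hc : 0 < c) : geoTail c < 1 :=
  Real.rpow_lt_one_of_one_lt_of_neg (by norm_num)
    (div_neg_of_neg_of_pos (by norm_num) (by linarith))

theorem geometricMeasure_geoParam_singleton {c : ℝ} (hc : 0 < c) (k : ℕ) :
    geometricMeasure (geoParam c hc) {k} = ENNReal.ofReal (geoTail c ^ k * (1 - geoTail c)) := by
  have hval : (geoParam c hc : ℝ) = 1 - geoTail c := rfl
  have hne : geoParam c hc ≠ 0 := by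
    intro h
    rw [h] at hval
    have := geoTail_lt_one hc
    simp at hval
    linarith
  rw [geometricMeasure_singleton hne, hval]
  congr 2
  ring

/-- A lower bound for the probability that a sampled ID exceeds `2 ^ K`. -/
noncomputable def exceedProb (c : ℝ) (K : ℕ) : ℝ :=
  geoTail c ^ K * (1 - geoTail c) / 2

theorem exceedProb_nonneg {c : ℝ} (hc : 0 < c) (K : ℕ) : 0 ≤ exceedProb c K := by
  have h1 := geoTail_pos c
  have h2 := geoTail_lt_one hc
  unfold exceedProb
  have : 0 ≤ 1 - geoTail c := by linarith
  positivity

theorem sampledId_Iic_le {c : ℝ} (hc : 0 < c) (K : ℕ) :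
    (sampledId c hc).toMeasure (Set.Iic (2 ^ K)) ≤ ENNReal.ofReal (1 - exceedProb c K) := by
  have h1 : ENNReal.ofReal (exceedProb c K) ≤
      (sampledId c hc).toMeasure (Set.Ioi (2 ^ K)) := by
    rw [sampledId, PMF.toMeasure_bind_apply _ _ _ measurableSet_Ioi]
    -- Only strings of length K + 1 are kept; this costs just a constant factor.
    refine le_trans ?_ (ENNReal.le_tsum K)
    rw [Measure.toPMF_apply, geometricMeasure_geoParam_singleton hc, exceedProb, div_eq_mul_inv,
      ENNReal.ofReal_mul' (by norm_num)]
    gcongr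
    refine le_trans (le_of_eq ?_) (half_le_map_bitsToId K)
    rw [ENNReal.ofReal_inv_of_pos (by norm_num)]
    norm_num
  rw [← Set.compl_Ioi, prob_compl_eq_one_sub measurableSet_Ioi,
    ENNReal.ofReal_sub _ (exceedProb_nonneg hc K), ENNReal.ofReal_one]
  exact tsub_le_tsub_left h1 1

/-! ### Collisions in product measures -/

/-- Split according to the common value x. Requiring u to take it costs a factor δ by independence,
and the events that v takes it are disjoint, so no factor is lost in the sum. The box S allows
conditioning on the initial IDs. -/
theorem measure_pi_collision_le {ι Ω : Type*} [Fintype ι] [MeasurableSpace Ω] (μ : Measure Ω)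
    [IsProbabilityMeasure μ] {g : Ω → ℕ} (hg : Measurable g) {S : ι → Set Ω}
    (hS : ∀ i, MeasurableSet (S i)) {u v : ι} (huv : u ≠ v) (X : Set ℕ) {δ : ENNReal}
    (h : ∀ x ∈ X, μ (S u ∩ g ⁻¹' {x}) ≤ δ * μ (S u)) :
    Measure.pi (fun _ : ι => μ) {ω | (∀ i, ω i ∈ S i) ∧ g (ω u) ∈ X ∧ g (ω u) = g (ω v)} ≤
      δ * Measure.pi (fun _ : ι => μ) (Set.univ.pi S) := by
  classical
  let R : ℕ → ι → Set Ω := fun x i => if i = v then S i ∩ g ⁻¹' {x} else S i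
  let Q : ℕ → ι → Set Ω := fun x i => if i = u then S i ∩ g ⁻¹' {x} else R x i
  have hRm : ∀ x, MeasurableSet (Set.univ.pi (R x)) := by
    refine fun x => MeasurableSet.univ_pi fun i => ?_
    simp only [R]
    split_ifs
    exacts [(hS i).inter (hg (measurableSet_singleton x)), hS i]
  have hdisj : Pairwise (Function.onFun Disjoint fun x : X => Set.univ.pi (R x)) := by
    intro x y hxy
    refine Set.disjoint_left.2 fun ω hx hy => hxy (Subtype.ext ?_)
    have h1 := hx v (Set.mem_univ v)
    have h2 := hy v (Set.mem_univ v)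
    simp only [R, if_true] at h1 h2
    exact h1.2.symm.trans h2.2
  have hQR : ∀ x : X, Measure.pi (fun _ : ι => μ) (Set.univ.pi (Q x)) ≤
      δ * Measure.pi (fun _ : ι => μ) (Set.univ.pi (R x)) := by
    intro x
    rw [Measure.pi_pi, Measure.pi_pi, ← Finset.mul_prod_erase _ _ (Finset.mem_univ u),
      ← Finset.mul_prod_erase _ _ (Finset.mem_univ u), ← mul_assoc]
    refine mul_le_mul' ?_ (le_of_eq (Finset.prod_congr rfl fun i hi => ?_))
    · simpa [Q, R, huv] using h x x.2
    · simp [Q, Finset.ne_of_mem_erase hi]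
  calc _ ≤ Measure.pi (fun _ : ι => μ) (⋃ x : X, Set.univ.pi (Q x)) := by
        refine measure_mono fun ω hω => Set.mem_iUnion.2 ⟨⟨g (ω u), hω.2.1⟩, fun i _ => ?_⟩
        simp only [Q, R]
        split_ifs with h1 h2
        · exact ⟨hω.1 i, by rw [h1]; rfl⟩
        · exact ⟨hω.1 i, by rw [h2]; exact hω.2.2.symm⟩
        · exact hω.1 i
    _ ≤ ∑' x : X, Measure.pi (fun _ : ι => μ) (Set.univ.pi (Q x)) := measure_iUnion_le _
    _ ≤ ∑' x : X, δ * Measure.pi (fun _ : ι => μ) (Set.univ.pi (R x)) :=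
        ENNReal.tsum_le_tsum hQR
    _ = δ * Measure.pi (fun _ : ι => μ) (⋃ x : X, Set.univ.pi (R x)) := by
        rw [ENNReal.tsum_mul_left, measure_iUnion hdisj fun x => hRm x]
    _ ≤ _ := by
        refine mul_le_mul_right (measure_mono (Set.iUnion_subset fun x => Set.pi_mono fun i _ => ?_)) _
        simp only [R]
        split_ifs
        exacts [Set.inter_subset_left, subset_rfl]

/-! ### The bad events -/

section Events

variable (c : ℝ) (hc : 0 < c)

instance : IsProbabilityMeasure (nodeSourceLaw c hc) := by
  unfold nodeSourceLaw
  infer_instance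

instance (n : ℕ) [NeZero n] : IsProbabilityMeasure (networkLaw c hc n) := by
  unfold networkLaw
  infer_instance

theorem nodeSourceLaw_fst (s : Set ℕ) :
    nodeSourceLaw c hc {src | src.1 ∈ s} = (sampledId c hc).toMeasure s := by
  have : {src : NodeSource | src.1 ∈ s} = s ×ˢ Set.univ := by ext; simp
  rw [this, nodeSourceLaw, Measure.prod_prod, measure_univ, mul_one]

theorem nodeSourceLaw_fst_coin (s : Set ℕ) (i : ℕ × ℕ) (x : ℕ) :
    nodeSourceLaw c hc ({src | src.1 ∈ s} ∩ {src | src.2 i = x}) =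
      uniformUpTo i.2 x * nodeSourceLaw c hc {src | src.1 ∈ s} := by
  have : ({src | src.1 ∈ s} ∩ {src | src.2 i = x} : Set NodeSource) =
      s ×ˢ ((fun f => f i) ⁻¹' {x}) := by ext; simp
  have hx : MeasurableSet ({x} : Set ℕ) := measurableSet_singleton x
  rw [nodeSourceLaw_fst, this, nodeSourceLaw, Measure.prod_prod, mul_comm,
    (measurePreserving_eval_infinitePi _ i).measure_preimage hx.nullMeasurableSet,
    PMF.toMeasure_apply_singleton _ _ hx]

theorem uniformUpTo_apply (m x : ℕ) : uniformUpTo m x =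
    if x ∈ Finset.Icc 1 (max 1 m) then ((Finset.Icc 1 (max 1 m)).card : ENNReal)⁻¹ else 0 := by
  have h : (Finset.Icc 1 (max 1 m)).Nonempty := ⟨1, by simp⟩
  refine (PMF.uniformOfFinset_apply h x).trans ?_
  congr

theorem uniformUpTo_apply_le {m : ℕ} (x : ℕ) (hm : 1 ≤ m) :
    uniformUpTo m x ≤ (m : ENNReal)⁻¹ := by
  rw [uniformUpTo_apply]
  split_ifs
  · simp [hm]
  · simp

theorem ae_regular : ∀ᵐ src ∂nodeSourceLaw c hc, src.Regular := by
  have h1 : ∀ᵐ src ∂nodeSourceLaw c hc, 1 ≤ src.1 := by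
    have := nodeSourceLaw_fst c hc {0}
    rw [PMF.toMeasure_apply_singleton _ _ (measurableSet_singleton 0), sampledId_zero] at this
    rw [ae_iff]
    convert this using 3
    simp
  have h2 : ∀ᵐ src ∂nodeSourceLaw c hc, ∀ (i : ℕ × ℕ) (x : ℕ), x ∉ Finset.Icc 1 (max 1 i.2) →
      src.2 i ≠ x := by
    rw [ae_all_iff]
    refine fun i => ae_all_iff.2 fun x => ?_
    by_cases hx : x ∈ Finset.Icc 1 (max 1 i.2)
    · exact Filter.Eventually.of_forall fun _ h => absurd hx h
    · have := nodeSourceLaw_fst_coin c hc Set.univ i x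
      rw [uniformUpTo_apply, if_neg hx, zero_mul] at this
      rw [ae_iff]
      convert this using 2
      ext
      simp [hx]
  filter_upwards [h1, h2] with src h1 h2
  exact ⟨h1, fun j m => by_contra fun h => h2 (j, m) _ h rfl⟩

variable (n : ℕ) [NeZero n]

theorem ae_forall_regular : ∀ᵐ ω ∂networkLaw c hc n, ∀ v, (ω v).Regular :=
  ae_all_iff.2 fun v =>
    (measurePreserving_eval (fun _ => nodeSourceLaw c hc) v).quasiMeasurePreserving.ae
      (ae_regular c hc)

theorem networkLaw_forall_id_le (K : ℕ) :
    networkLaw c hc n {ω | ∀ v, (ω v).1 ≤ 2 ^ K} ≤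
      ENNReal.ofReal (Real.exp (-(n * exceedProb c K))) := by
  have : {ω : ZMod n → NodeSource | ∀ v, (ω v).1 ≤ 2 ^ K} =
      Set.univ.pi fun _ => {src : NodeSource | src.1 ∈ Set.Iic (2 ^ K)} := by ext; simp
  rw [this, networkLaw, Measure.pi_pi]
  simp only [nodeSourceLaw_fst, Finset.prod_const, Finset.card_univ, ZMod.card]
  calc _ ≤ ENNReal.ofReal (Real.exp (-exceedProb c K)) ^ n := by
        gcongr
        refine (sampledId_Iic_le hc K).trans (ENNReal.ofReal_le_ofReal ?_)
        linarith [Real.add_one_le_exp (-exceedProb c K)]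
    _ = _ := by
        rw [← ENNReal.ofReal_pow (Real.exp_pos _).le, ← Real.exp_nat_mul]
        congr 2
        ring

theorem networkLaw_id_collision_le (T : ℕ) {u v : ZMod n} (huv : u ≠ v) :
    networkLaw c hc n {ω | T < (ω u).1 ∧ (ω u).1 = (ω v).1} ≤ (T : ENNReal)⁻¹ := by
  have := measure_pi_collision_le (nodeSourceLaw c hc) (g := Prod.fst) measurable_fst
    (S := fun _ => Set.univ) (fun _ => MeasurableSet.univ) huv (Set.Ioi T)
    (δ := (T : ENNReal)⁻¹) (by
      intro x hx
      have h1 := nodeSourceLaw_fst c hc {x}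
      rw [PMF.toMeasure_apply_singleton _ _ (measurableSet_singleton x)] at h1
      rw [Set.univ_inter, measure_univ, mul_one]
      refine (le_of_eq h1).trans ((sampledId_apply_le c hc x).trans (ENNReal.inv_le_inv.2 ?_))
      exact_mod_cast (Set.mem_Ioi.1 hx).le)
  simpa [networkLaw] using this

/-- The coin index is random but is a function of the ID vector. On each of the countably many
events fixing that vector, it is constant and the coins are still independent and uniform. -/
theorem networkLaw_coin_collision_le {T : ℕ} (hT : 1 ≤ T) (J N : (ZMod n → ℕ) → ℕ)
    {u v : ZMod n} (huv : u ≠ v) :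
    networkLaw c hc n {ω | T ≤ N (fun w => (ω w).1) ∧
      (ω u).2 (J fun w => (ω w).1, N fun w => (ω w).1) =
        (ω v).2 (J fun w => (ω w).1, N fun w => (ω w).1)} ≤ (T : ENNReal)⁻¹ := by
  let S : (ZMod n → ℕ) → ZMod n → Set NodeSource := fun a w => {src | src.1 ∈ ({a w} : Set ℕ)}
  have hS : ∀ a w, MeasurableSet (S a w) := fun a w =>
    measurable_fst (measurableSet_singleton (a w))
  have hdisj : Pairwise (Function.onFun Disjoint fun a => Set.univ.pi (S a)) := by
    intro a b hab
    refine Set.disjoint_left.2 fun ω ha hb => hab (funext fun w => ?_)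
    exact (ha w (Set.mem_univ w)).symm.trans (hb w (Set.mem_univ w))
  have hle : ∀ a, networkLaw c hc n {ω | T ≤ N a ∧ (∀ w, ω w ∈ S a w) ∧
      (ω u).2 (J a, N a) ∈ Set.univ ∧ (ω u).2 (J a, N a) = (ω v).2 (J a, N a)} ≤
      (T : ENNReal)⁻¹ * networkLaw c hc n (Set.univ.pi (S a)) := by
    intro a
    by_cases ha : T ≤ N a
    · simp only [ha, true_and]
      refine measure_pi_collision_le (nodeSourceLaw c hc)
        (g := fun src : NodeSource => src.2 (J a, N a))
        ((measurable_pi_apply _).comp measurable_snd) (hS a) huv Set.univ fun x _ => ?_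
      refine (le_of_eq (nodeSourceLaw_fst_coin c hc {a u} (J a, N a) x)).trans ?_
      refine mul_le_mul_left ((uniformUpTo_apply_le x (hT.trans ha)).trans ?_) _
      exact ENNReal.inv_le_inv.2 (by exact_mod_cast ha)
    · simp [ha]
  calc _ ≤ networkLaw c hc n (⋃ a, {ω | T ≤ N a ∧ (∀ w, ω w ∈ S a w) ∧
        (ω u).2 (J a, N a) ∈ Set.univ ∧ (ω u).2 (J a, N a) = (ω v).2 (J a, N a)}) :=
        measure_mono fun ω hω => Set.mem_iUnion.2
          ⟨fun w => (ω w).1, hω.1, fun w => rfl, trivial, hω.2⟩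
    _ ≤ ∑' a, (T : ENNReal)⁻¹ * networkLaw c hc n (Set.univ.pi (S a)) :=
        (measure_iUnion_le _).trans (ENNReal.tsum_le_tsum hle)
    _ = (T : ENNReal)⁻¹ * networkLaw c hc n (⋃ a, Set.univ.pi (S a)) := by
        rw [ENNReal.tsum_mul_left, measure_iUnion hdisj fun a => MeasurableSet.univ_pi (hS a)]
    _ ≤ (T : ENNReal)⁻¹ := mul_le_of_le_one_right' prob_le_one

/-- The failure probability, in terms of a cutoff `2 ^ K` for the IDs. -/
theorem networkLaw_not_distinct_le (rule : VirtualIdRule) (flip : ZMod n → Bool) (K : ℕ) :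
    networkLaw c hc n {ω | ¬ DistinctIdsAtQuiescence rule flip ω} ≤
      ENNReal.ofReal (Real.exp (-(n * exceedProb c K)) + 2 * ((n : ℝ) ^ 2 / 2 ^ K)) := by
  let B : ZMod n × ZMod n → Set (ZMod n → NodeSource) := fun x =>
    {ω | x.1 ≠ x.2 ∧ 2 ^ K < (ω x.1).1 ∧ (ω x.1).1 = (ω x.2).1}
  let D : ZMod n × ZMod n → Set (ZMod n → NodeSource) := fun x =>
    {ω | x.1 ≠ x.2 ∧ 2 ^ K ≤ finalMin rule flip ω - 1 ∧
      (ω x.1).2 (finalSum rule flip ω, finalMin rule flip ω - 1) =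
        (ω x.2).2 (finalSum rule flip ω, finalMin rule flip ω - 1)}
  have hB : ∀ x, networkLaw c hc n (B x) ≤ ((2 ^ K : ℕ) : ENNReal)⁻¹ := by
    intro x
    by_cases hx : x.1 = x.2
    · simp [B, hx]
    · exact (measure_mono fun ω hω => hω.2).trans (networkLaw_id_collision_le c hc n (2 ^ K) hx)
  have hD : ∀ x, networkLaw c hc n (D x) ≤ ((2 ^ K : ℕ) : ENNReal)⁻¹ := by
    intro x
    by_cases hx : x.1 = x.2
    · simp [D, hx]
    · exact (measure_mono fun ω hω => hω.2).trans
        (networkLaw_coin_collision_le c hc n Nat.one_le_two_pow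
          -- The final counts read only the initial IDs, so the zero coins are placeholders.
          (fun a => finalSum rule flip fun w => (a w, fun _ => 0))
          (fun a => finalMin rule flip (fun w => (a w, fun _ => 0)) - 1) hx)
  have hsum : ∀ F : ZMod n × ZMod n → Set (ZMod n → NodeSource),
      (∀ x, networkLaw c hc n (F x) ≤ ((2 ^ K : ℕ) : ENNReal)⁻¹) →
      networkLaw c hc n (⋃ x, F x) ≤ ENNReal.ofReal ((n : ℝ) ^ 2 / 2 ^ K) := by
    intro F hF
    refine (measure_iUnion_fintype_le _ F).trans ((Finset.sum_le_sum fun x _ => hF x).trans ?_)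
    rw [Finset.sum_const, Finset.card_univ, Fintype.card_prod, ZMod.card, nsmul_eq_mul,
      ENNReal.ofReal_div_of_pos (by positivity), div_eq_mul_inv]
    refine le_of_eq ?_
    congr 1
    · rw [← Nat.cast_pow, ENNReal.ofReal_natCast, sq]
    · congr 1
      rw [← ENNReal.ofReal_natCast]
      push_cast
      rfl
  calc _ ≤ networkLaw c hc n ({ω | ∀ v, (ω v).1 ≤ 2 ^ K} ∪ ((⋃ x, B x) ∪ ⋃ x, D x)) := by
        -- Regularity of the sources holds only almost surely.
        refine measure_mono_ae ?_
        filter_upwards [ae_forall_regular c hc n] with ω hω h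
        rcases bad_of_not_distinctIdsAtQuiescence hω Nat.one_le_two_pow h with
          h | ⟨u, v, huv, h | h⟩
        · exact Or.inl h
        · exact Or.inr (Or.inl (Set.mem_iUnion.2 ⟨(u, v), huv, h⟩))
        · exact Or.inr (Or.inr (Set.mem_iUnion.2 ⟨(u, v), huv, h⟩))
    _ ≤ ENNReal.ofReal (Real.exp (-(n * exceedProb c K))) +
          (ENNReal.ofReal ((n : ℝ) ^ 2 / 2 ^ K) + ENNReal.ofReal ((n : ℝ) ^ 2 / 2 ^ K)) :=
        (measure_union_le _ _).trans (add_le_add (networkLaw_forall_id_le c hc n K)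
          ((measure_union_le _ _).trans (add_le_add (hsum B hB) (hsum D hD))))
    _ = _ := by
        rw [← ENNReal.ofReal_add (by positivity) (by positivity),
          ← ENNReal.ofReal_add (by positivity) (by positivity)]
        congr 1
        ring

end Events

/-! ### Asymptotics -/

open Filter in
theorem exists_forall_failure_le {c : ℝ} (hc : 0 < c) : ∃ n₀ : ℕ, ∀ n : ℕ, n₀ ≤ n → ∃ K : ℕ,
    Real.exp (-(n * exceedProb c K)) + 2 * ((n : ℝ) ^ 2 / 2 ^ K) ≤ (n : ℝ) ^ (-(1 / 4 * c)) := by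
  have hp0 := geoTail_pos c
  have hp1 := geoTail_lt_one hc
  -- γ = 1 - (2 + c/2)/(c + 2), the exponent of n in n p^K when 2^K is n^(2 + c/2).
  set γ : ℝ := c / 2 / (c + 2) with hγ
  have hγ0 : 0 < γ := by positivity
  set a : ℝ := geoTail c * (1 - geoTail c) / 2 with ha
  have ha0 : 0 < a := by
    have : 0 < 1 - geoTail c := by linarith
    positivity
  have h1 : ∀ᶠ n : ℕ in atTop, Real.exp (-a * (n : ℝ) ^ γ) ≤ (n : ℝ) ^ (-(c / 2)) := by
    have ht : Tendsto (fun n : ℕ => (n : ℝ) ^ γ) atTop atTop :=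
      (tendsto_rpow_atTop hγ0).comp tendsto_natCast_atTop_atTop
    -- Applied at y = n^γ, where y^(-(c/2)/γ) = n^(-c/2).
    have ho := ((isLittleO_exp_neg_mul_rpow_atTop ha0 (-(c / 2) / γ)).comp_tendsto ht).bound
      (c := 1) one_pos
    filter_upwards [ho] with n hn
    simp only [Function.comp_apply, one_mul, Real.norm_eq_abs] at hn
    rw [abs_of_pos (Real.exp_pos _), abs_of_nonneg (by positivity),
      ← Real.rpow_mul (Nat.cast_nonneg n), mul_div_cancel₀ _ hγ0.ne'] at hn
    exact hn
  have h2 : ∀ᶠ n : ℕ in atTop, (3 : ℝ) ≤ (n : ℝ) ^ (c / 4) :=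
    ((tendsto_rpow_atTop (by positivity)).comp tendsto_natCast_atTop_atTop).eventually_ge_atTop 3
  obtain ⟨n₀, hn₀⟩ := eventually_atTop.1 (h1.and (h2.and (eventually_ge_atTop 1)))
  refine ⟨n₀, fun n hn => ?_⟩
  obtain ⟨h1, h2, h3⟩ := hn₀ n hn
  have hn0 : (0 : ℝ) < n := by exact_mod_cast h3
  set L : ℝ := Real.logb 2 n with hL
  have hL0 : 0 ≤ L := Real.logb_nonneg (by norm_num) (by exact_mod_cast h3)
  have hnL : (2 : ℝ) ^ L = n := Real.rpow_logb (by norm_num) (by norm_num) hn0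
  refine ⟨⌈(2 + c / 2) * L⌉₊, ?_⟩
  set K := ⌈(2 + c / 2) * L⌉₊
  have hK1 : (2 + c / 2) * L ≤ K := Nat.le_ceil _
  have hK2 : (K : ℝ) ≤ (2 + c / 2) * L + 1 := (Nat.ceil_lt_add_one (by positivity)).le
  have hcut : (n : ℝ) ^ 2 / 2 ^ K ≤ (n : ℝ) ^ (-(c / 2)) := by
    rw [div_le_iff₀ (by positivity)]
    calc (n : ℝ) ^ 2 = (n : ℝ) ^ (-(c / 2)) * (n : ℝ) ^ (2 + c / 2) := by
          rw [← Real.rpow_add hn0, ← Real.rpow_natCast]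
          congr 1
          push_cast
          ring
      _ ≤ (n : ℝ) ^ (-(c / 2)) * 2 ^ K := by
          gcongr
          rw [← Real.rpow_natCast 2 K]
          nth_rw 1 [← hnL]
          rw [← Real.rpow_mul (by norm_num)]
          exact Real.rpow_le_rpow_of_exponent_le (by norm_num) (by linarith)
  -- The factor `geoTail c` on the left pays for rounding K up.
  have htail : geoTail c * (n : ℝ) ^ γ ≤ n * geoTail c ^ K := by
    have e1 : geoTail c * (n : ℝ) ^ γ = (2 : ℝ) ^ (-1 / (c + 2) + L * γ) := by
      rw [Real.rpow_add (by norm_num), Real.rpow_mul (by norm_num), hnL, geoTail]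
    have e2 : n * geoTail c ^ K = (2 : ℝ) ^ (L + -1 / (c + 2) * K) := by
      rw [Real.rpow_add (by norm_num), Real.rpow_mul (by norm_num), hnL, geoTail,
        Real.rpow_natCast]
    rw [e1, e2]
    refine Real.rpow_le_rpow_of_exponent_le (by norm_num) ?_
    have : 0 < c + 2 := by linarith
    rw [hγ, ← sub_nonneg]
    have : L + -1 / (c + 2) * K - (-1 / (c + 2) + L * (c / 2 / (c + 2))) =
        ((2 + c / 2) * L + 1 - K) / (c + 2) := by
      field_simp
      ring
    rw [this]
    exact div_nonneg (by linarith) (by linarith)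
  have hexp : Real.exp (-(n * exceedProb c K)) ≤ (n : ℝ) ^ (-(c / 2)) := by
    refine le_trans (Real.exp_le_exp.2 ?_) h1
    rw [exceedProb, ha]
    nlinarith [mul_le_mul_of_nonneg_right htail (show 0 ≤ (1 - geoTail c) / 2 by linarith)]
  calc _ ≤ 3 * (n : ℝ) ^ (-(c / 2)) := by linarith
    _ ≤ (n : ℝ) ^ (c / 4) * (n : ℝ) ^ (-(c / 2)) := by gcongr
    _ = _ := by
        rw [← Real.rpow_add hn0]
        congr 1
        ring

end AnonRing

/-- With high probability, i.e. except with probability `n ^ (-Ω(c))`, all nodes hold distinct IDs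
at quiescence, for every assignment of the ports and whatever the scheduler does. -/
theorem mainTheorem6 :
    ∃ κ : ℝ, 0 < κ ∧ ∀ (c : ℝ) (hc : 0 < c), ∃ n₀ : ℕ, ∀ (n : ℕ) [NeZero n], n₀ ≤ n →
      ∀ (rule : AnonRing.VirtualIdRule) (flip : ZMod n → Bool),
        AnonRing.networkLaw c hc n {ω | ¬ AnonRing.DistinctIdsAtQuiescence rule flip ω} ≤
          ENNReal.ofReal ((n : ℝ) ^ (-(κ * c))) := by
  -- The three error terms total at most 3 n^(-c/2), and n^(c/4) absorbs the 3.
  refine ⟨1 / 4, by norm_num, fun c hc => ?_⟩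
  obtain ⟨n₀, hn₀⟩ := AnonRing.exists_forall_failure_le hc
  refine ⟨n₀, fun n _ hn rule flip => ?_⟩
  obtain ⟨K, hK⟩ := hn₀ n hn
  exact (AnonRing.networkLaw_not_distinct_le c hc n rule flip K).trans
    (ENNReal.ofReal_le_ofReal hK)
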